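/- Let $M$ be a smooth (Hausdorff, paracompact) $7$-manifold with a $G_2$-structure, that is, a smooth Riemannian metric $(\cdot,\cdot)$ and a smooth $3$-form $\lambda$ such that each tangent space $T_xM$ admits a linear isometry onto the space $\mathrm{Im}\,\mathbb O\cong\mathbb R^7$ of imaginary octonions taking $\lambda$ to the standard form $(a,b,c)\mapsto(\mathrm{Im}(ab),c)$; in particular, $M$ may be any $G_2$-manifold. Let $[\cdot,\cdot]$ be the vector product on the tangent spaces of $M$ defined by $([a,b],c)=\lambda(a,b,c)$. Let $T^0(M)$ be the complement of the zero section in $TM$, let $p:T^0(M)\to M$ be the projection, and let $I$ be the quotient of $p^*TM$ by its tautological line subbundle, identified with the bundle over $T^0(M)$ whose fibre at $v\in T^0(M)$ is the orthogonal complement of $v$ in $T_{p(v)}M$ (over the unit sphere bundle this is the tangent bundle along the fibres of $p$). Regard $I$ as a complex vector bundle of rank $3$ with the complex structure $J(w)=[e_0,w]$, where $e_0=v/|v|$. Then the first Chern class of $I$ is zero: $$c_1(I)=0\in H^2(T^0(M);\mathbb Z).$$ -/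

import Mathlib

open Bundle Manifold Set TopologicalSpace
open scoped ContDiff

noncomputable section

/-! ## Čech cohomology in degree two with integer coefficients -/

/-- An open cover of `X` indexed by the points of `X`, the member with index `x` being an open
neighbourhood of `x`. Every open cover has a refinement of this kind. -/
structure PointCover (X : Type*) [TopologicalSpace X] where
  /-- the members of the cover -/
  nhd : X → Set X
  isOpen (x : X) : IsOpen (nhd x)
  mem (x : X) : x ∈ nhd x

namespace PointCover

/-- The common refinement of two covers. -/
def inf {X : Type*} [TopologicalSpace X] (U V : PointCover X) : PointCover X where
  nhd x := U.nhd x ∩ V.nhd x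
  isOpen x := (U.isOpen x).inter (V.isOpen x)
  mem x := ⟨U.mem x, V.mem x⟩

/-- The one-element cover. -/
def top (X : Type*) [TopologicalSpace X] : PointCover X where
  nhd _ := univ
  isOpen _ := isOpen_univ
  mem _ := mem_univ _

end PointCover

namespace Cech

variable {X : Type*} [TopologicalSpace X]

/-- The coboundary of a `1`-cochain `f`: here `f x y p` is the value at the point `p` of the
component of `f` on the intersection of the members with indices `x` and `y`. -/
def d1 {A : Type*} [AddCommGroup A] (f : X → X → X → A) : X → X → X → X → A :=
  fun x y z p => f y z p - f x z p + f x y p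

/-- The coboundary of a `2`-cochain. -/
def d2 {A : Type*} [AddCommGroup A] (c : X → X → X → X → A) : X → X → X → X → X → A :=
  fun x y z w p => c y z w p - c x z w p + c x y w p - c x y z p

/-- Integral `2`-cocycles of point-indexed covers of `X`: on all the triple intersections of some
cover the components are continuous (that is, locally constant), and the coboundary vanishes on
its quadruple intersections. Values outside the intersections are immaterial. -/
def Z2 (X : Type*) [TopologicalSpace X] : AddSubgroup (X → X → X → X → ℤ) where
  carrier := {c | ∃ U : PointCover X,
    (∀ x y z, ContinuousOn (c x y z) (U.nhd x ∩ U.nhd y ∩ U.nhd z)) ∧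
    ∀ x y z w, ∀ p ∈ U.nhd x ∩ U.nhd y ∩ U.nhd z ∩ U.nhd w, d2 c x y z w p = 0}
  zero_mem' := ⟨PointCover.top X, fun _ _ _ => continuousOn_const, fun _ _ _ _ _ _ => by simp [d2]⟩
  add_mem' := by
    rintro a b ⟨U, hU, hU'⟩ ⟨V, hV, hV'⟩
    refine ⟨U.inf V, fun x y z => ?_, fun x y z w p hp => ?_⟩
    · exact ((hU x y z).mono fun p hp => ⟨⟨hp.1.1.1, hp.1.2.1⟩, hp.2.1⟩).add
        ((hV x y z).mono fun p hp => ⟨⟨hp.1.1.2, hp.1.2.2⟩, hp.2.2⟩)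
    · have h1 := hU' x y z w p ⟨⟨⟨hp.1.1.1.1, hp.1.1.2.1⟩, hp.1.2.1⟩, hp.2.1⟩
      have h2 := hV' x y z w p ⟨⟨⟨hp.1.1.1.2, hp.1.1.2.2⟩, hp.1.2.2⟩, hp.2.2⟩
      simp only [d2, Pi.add_apply] at h1 h2 ⊢
      linarith
  neg_mem' := by
    rintro a ⟨U, hU, hU'⟩
    refine ⟨U, fun x y z => (hU x y z).neg, fun x y z w p hp => ?_⟩
    have h1 := hU' x y z w p hp
    simp only [d2, Pi.neg_apply] at h1 ⊢
    linarith

/-- Integral `2`-coboundaries: the cocycles which, on the triple intersections of some cover,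
agree with the coboundary of a locally constant integral `1`-cochain. In particular cocycles
which agree on a finer cover become equal in the quotient by `B2 X`. -/
def B2 (X : Type*) [TopologicalSpace X] : AddSubgroup (Z2 X) where
  carrier := {c | ∃ (U : PointCover X) (b : X → X → X → ℤ),
    (∀ x y, ContinuousOn (b x y) (U.nhd x ∩ U.nhd y)) ∧
    ∀ x y z, ∀ p ∈ U.nhd x ∩ U.nhd y ∩ U.nhd z, c.1 x y z p = d1 b x y z p}
  zero_mem' := ⟨PointCover.top X, 0, fun _ _ => continuousOn_const, fun _ _ _ _ _ => by simp [d1]⟩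
  add_mem' := by
    rintro a b ⟨U, f, hU, hU'⟩ ⟨V, g, hV, hV'⟩
    refine ⟨U.inf V, f + g, fun x y => ?_, fun x y z p hp => ?_⟩
    · exact ((hU x y).mono fun p hp => ⟨hp.1.1, hp.2.1⟩).add
        ((hV x y).mono fun p hp => ⟨hp.1.2, hp.2.2⟩)
    · have h1 := hU' x y z p ⟨⟨hp.1.1.1, hp.1.2.1⟩, hp.2.1⟩
      have h2 := hV' x y z p ⟨⟨hp.1.1.2, hp.1.2.2⟩, hp.2.2⟩
      simp only [d1, Pi.add_apply, AddSubgroup.coe_add] at h1 h2 ⊢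
      linarith
  neg_mem' := by
    rintro a ⟨U, f, hU, hU'⟩
    refine ⟨U, -f, fun x y => (hU x y).neg, fun x y z p hp => ?_⟩
    have h1 := hU' x y z p hp
    simp only [d1, Pi.neg_apply, AddSubgroup.coe_neg] at h1 ⊢
    linarith

/-- The Čech cohomology group `H²(X; ℤ)`: the direct limit, over the open covers of `X`, of the
second cohomology groups of the complexes of locally constant integral cochains. -/
abbrev H2 (X : Type*) [TopologicalSpace X] : Type _ := Z2 X ⧸ B2 X

end Cech

/-! ## The first Chern class of a complex vector bundle -/

/-- The sections `s 0, …, s (n - 1)` are continuous on `U` and form a complex basis of the fibre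
over each point of `U`. -/
structure IsComplexFrameOn {X : Type*} (F : Type*) {E : X → Type*} [TopologicalSpace X]
    [∀ x, AddCommGroup (E x)] [∀ x, Module ℂ (E x)] [TopologicalSpace (TotalSpace F E)]
    {n : ℕ} (U : Set X) (s : Fin n → ∀ x, E x) : Prop where
  continuousOn (k : Fin n) : ContinuousOn (fun x => TotalSpace.mk' F x (s k x)) U
  linearIndependent (x : X) (hx : x ∈ U) : LinearIndependent ℂ fun k => s k x
  span_eq_top (x : X) (hx : x ∈ U) : Submodule.span ℂ (range fun k => s k x) = ⊤

/-- `c` is the first Chern class of the rank `n` complex vector bundle `E` over `X`: the image,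
under the connecting homomorphism of the exponential sequence
`0 → ℤ → C(·, ℂ) → C(·, ℂˣ) → 0`, of the Čech cocycle of determinants of transition matrices.
In detail: `s x` is a frame over the member `U x` of a cover, `s y = s x · A x y` over
`U x ∩ U y`, `det A x y = exp (2πi f x y)` with `f x y` continuous, and `c` is the class of the
integral cocycle `m` which is the coboundary of `f`. -/
def IsFirstChernClass {X : Type*} (F : Type*) (E : X → Type*) [TopologicalSpace X]
    [∀ x, AddCommGroup (E x)] [∀ x, Module ℂ (E x)] [TopologicalSpace (TotalSpace F E)]
    (n : ℕ) (c : Cech.H2 X) : Prop :=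
  ∃ (U : PointCover X) (s : X → Fin n → ∀ p, E p)
    (A : X → X → X → Matrix (Fin n) (Fin n) ℂ) (f : X → X → X → ℂ) (m : Cech.Z2 X),
    (∀ x, IsComplexFrameOn F (U.nhd x) (s x)) ∧
    (∀ x y, ∀ p ∈ U.nhd x ∩ U.nhd y, ∀ b, s y b p = ∑ a, A x y p a b • s x a p) ∧
    (∀ x y, ContinuousOn (f x y) (U.nhd x ∩ U.nhd y)) ∧
    (∀ x y, ∀ p ∈ U.nhd x ∩ U.nhd y,
      (A x y p).det = Complex.exp (2 * Real.pi * Complex.I * f x y p)) ∧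
    (∀ x y z, ∀ p ∈ U.nhd x ∩ U.nhd y ∩ U.nhd z, (m.1 x y z p : ℂ) = Cech.d1 f x y z p) ∧
    c = QuotientAddGroup.mk m

/-! ## The vector product on `ℝ⁷` -/

/-- Seven-dimensional Euclidean space, the space of imaginary octonions. -/
abbrev E7 : Type := EuclideanSpace ℝ (Fin 7)

/-- The vector product of imaginary octonions, `a × b = Im (a b) = (a b - b a) / 2`, in a standard
basis `e₀, …, e₆` of imaginary units: `e₀e₁ = e₂`, `e₀e₃ = e₄`, `e₀e₅ = e₆`, `e₁e₃ = e₅`,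
`e₁e₄ = -e₆`, `e₂e₃ = -e₆`, `e₂e₄ = -e₅`, and cyclically. -/
def cross0 (u v : E7) : E7 :=
  !₂[(u 1 * v 2 - u 2 * v 1) + (u 3 * v 4 - u 4 * v 3) + (u 5 * v 6 - u 6 * v 5),
    (u 2 * v 0 - u 0 * v 2) + (u 3 * v 5 - u 5 * v 3) - (u 4 * v 6 - u 6 * v 4),
    (u 0 * v 1 - u 1 * v 0) - (u 3 * v 6 - u 6 * v 3) - (u 4 * v 5 - u 5 * v 4),
    (u 4 * v 0 - u 0 * v 4) + (u 5 * v 1 - u 1 * v 5) - (u 6 * v 2 - u 2 * v 6),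
    (u 0 * v 3 - u 3 * v 0) - (u 6 * v 1 - u 1 * v 6) - (u 5 * v 2 - u 2 * v 5),
    (u 6 * v 0 - u 0 * v 6) + (u 1 * v 3 - u 3 * v 1) - (u 2 * v 4 - u 4 * v 2),
    (u 0 * v 5 - u 5 * v 0) - (u 1 * v 4 - u 4 * v 1) - (u 2 * v 3 - u 3 * v 2)]

/-- The standard `3`-form `(a × b, c)` on the imaginary octonions, whose stabilizer in
`GL(7, ℝ)` is the group `G₂`. -/
def phi0 (u v w : E7) : ℝ := inner ℝ (cross0 u v) w

theorem inner_E7 (u v : E7) : inner ℝ u v = u 0 * v 0 + u 1 * v 1 + u 2 * v 2 + u 3 * v 3 +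
    u 4 * v 4 + u 5 * v 5 + u 6 * v 6 := by
  simp [PiLp.inner_apply, Fin.sum_univ_succ, mul_comm]
  ring

theorem cross0_cross0 (u v : E7) :
    cross0 u (cross0 u v) = -(inner ℝ u u : ℝ) • v + (inner ℝ u v : ℝ) • u := by
  rw [inner_E7, inner_E7]
  ext i
  fin_cases i <;> simp [cross0] <;> ring

theorem phi0_left (u w : E7) : phi0 u w u = 0 := by
  simp [phi0, inner_E7, cross0]
  ring

/-! ## `G₂`-manifolds -/

instance instFiniteDimensionalTangentSpaceSeven {M : Type*} [TopologicalSpace M]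
    [ChartedSpace E7 M] (x : M) : FiniteDimensional ℝ (TangentSpace (𝓡 7) x) :=
  inferInstanceAs (FiniteDimensional ℝ E7)

/-- A `G₂`-structure on a smooth `7`-manifold: a smooth Riemannian metric and a smooth `3`-form
such that every tangent space is isometric to the space of imaginary octonions by a linear map
which takes the `3`-form to the standard one. Smoothness of the `3`-form means smoothness of its
components in local coordinates; that it is alternating is part of the last condition. -/
structure G2Structure (M : Type*) [TopologicalSpace M] [ChartedSpace E7 M]
    [IsManifold (𝓡 7) ∞ M] where
  /-- the Riemannian metric -/
  metric : ContMDiffRiemannianMetric (𝓡 7) ∞ E7 (fun x : M => TangentSpace (𝓡 7) x)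
  /-- the `3`-form -/
  form (x : M) : TangentSpace (𝓡 7) x →ₗ[ℝ] TangentSpace (𝓡 7) x →ₗ[ℝ]
    TangentSpace (𝓡 7) x →ₗ[ℝ] ℝ
  contMDiffOn_form (x₀ : M) (a b c : E7) : ContMDiffOn (𝓡 7) 𝓘(ℝ) ∞
    (fun x => form x ((trivializationAt E7 (TangentSpace (𝓡 7)) x₀).symm x a)
      ((trivializationAt E7 (TangentSpace (𝓡 7)) x₀).symm x b)
      ((trivializationAt E7 (TangentSpace (𝓡 7)) x₀).symm x c))
    (trivializationAt E7 (TangentSpace (𝓡 7)) x₀).baseSet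
  exists_model (x : M) : ∃ e : TangentSpace (𝓡 7) x ≃L[ℝ] E7,
    (∀ u v, metric.inner x u v = inner ℝ (e u) (e v)) ∧
    ∀ u v w, form x u v w = phi0 (e u) (e v) (e w)

namespace G2Structure

variable {M : Type*} [TopologicalSpace M] [ChartedSpace E7 M] [IsManifold (𝓡 7) ∞ M]
  (S : G2Structure M)

/-- The metric at `x`, as a bilinear form. -/
def bilin (x : M) : LinearMap.BilinForm ℝ (TangentSpace (𝓡 7) x) :=
  LinearMap.mk₂ ℝ (fun u v => S.metric.inner x u v) (by simp) (by simp) (by simp) (by simp)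

@[simp] theorem bilin_apply (x : M) (u v : TangentSpace (𝓡 7) x) :
    S.bilin x u v = S.metric.inner x u v := rfl

theorem bilin_nondegenerate (x : M) : (S.bilin x).Nondegenerate := by
  constructor
  · intro u hu
    by_contra h
    exact (S.metric.pos x u h).ne' (hu u)
  · intro u hu
    by_contra h
    exact (S.metric.pos x u h).ne' (hu u)

/-- The vector product `[·,·]` on the tangent space at `x`, determined by
`([u, v], w) = form x u v w`. -/
def cross (x : M) : TangentSpace (𝓡 7) x →ₗ[ℝ] TangentSpace (𝓡 7) x →ₗ[ℝ]
    TangentSpace (𝓡 7) x :=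
  (S.form x).compr₂ ((S.bilin x).toDual (S.bilin_nondegenerate x)).symm.toLinearMap

theorem inner_cross (x : M) (u v w : TangentSpace (𝓡 7) x) :
    S.metric.inner x (S.cross x u v) w = S.form x u v w :=
  LinearMap.BilinForm.apply_toDual_symm_apply (hB := S.bilin_nondegenerate x) (S.form x u v) w

theorem cross_cross (x : M) (u v : TangentSpace (𝓡 7) x) :
    S.cross x u (S.cross x u v) =
      -(S.metric.inner x u u) • v + (S.metric.inner x u v) • u := by
  obtain ⟨e, he, hf⟩ := S.exists_model x
  have key : ∀ a b, e (S.cross x a b) = cross0 (e a) (e b) := by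
    intro a b
    refine ext_inner_right ℝ fun w => ?_
    obtain ⟨w, rfl⟩ := e.surjective w
    rw [← he, inner_cross, hf, phi0]
  apply e.injective
  rw [key, key, cross0_cross0, map_add, map_smul, map_smul, he, he]

theorem inner_cross_self (x : M) (u w : TangentSpace (𝓡 7) x) :
    S.metric.inner x u (S.cross x u w) = 0 := by
  obtain ⟨e, -, hf⟩ := S.exists_model x
  rw [S.metric.symm, inner_cross, hf, phi0_left]

end G2Structure

/-! ## The complex bundle over the complement of the zero section -/

/-- The complement `T⁰(M)` of the zero section in the tangent bundle of `M`, with the subspace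
topology. -/
abbrev T0 (M : Type*) [TopologicalSpace M] [ChartedSpace E7 M] [IsManifold (𝓡 7) ∞ M] : Type _ :=
  {v : TangentBundle (𝓡 7) M // v.2 ≠ 0}

namespace G2Structure

variable {M : Type*} [TopologicalSpace M] [ChartedSpace E7 M] [IsManifold (𝓡 7) ∞ M]
  (S : G2Structure M)

/-- The fibre at `v ∈ T⁰(M)` of the bundle `I`: the orthogonal complement of `v` in the tangent
space of `M` at the foot point of `v`; it represents the quotient of that tangent space by the
line spanned by `v`, and if `v` has length one it is the tangent space at `v` to the fibre of the
unit sphere bundle. -/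
def perp (v : T0 M) : Submodule ℝ (TangentSpace (𝓡 7) v.1.1) :=
  LinearMap.ker (S.bilin v.1.1 v.1.2)

theorem mem_perp (v : T0 M) (w : TangentSpace (𝓡 7) v.1.1) :
    w ∈ S.perp v ↔ S.metric.inner v.1.1 v.1.2 w = 0 := Iff.rfl

/-- The unit vector `e₀ = v / |v|`. -/
def unit (v : T0 M) : TangentSpace (𝓡 7) v.1.1 :=
  (Real.sqrt (S.metric.inner v.1.1 v.1.2 v.1.2))⁻¹ • v.1.2

theorem inner_unit_unit (v : T0 M) : S.metric.inner v.1.1 (S.unit v) (S.unit v) = 1 := by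
  have h := S.metric.pos v.1.1 v.1.2 v.2
  have h' := Real.sqrt_pos.2 h
  simp only [unit, map_smul, smul_apply, smul_eq_mul]
  nth_rewrite 3 [← Real.mul_self_sqrt h.le]
  field_simp

theorem inner_unit_of_mem (v : T0 M) (w : TangentSpace (𝓡 7) v.1.1) (hw : w ∈ S.perp v) :
    S.metric.inner v.1.1 (S.unit v) w = 0 := by
  rw [mem_perp] at hw
  simp [unit, hw]

theorem cross_mem_perp (v : T0 M) (w : TangentSpace (𝓡 7) v.1.1) :
    S.cross v.1.1 (S.unit v) w ∈ S.perp v := by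
  have h : S.metric.inner v.1.1 v.1.2 (S.cross v.1.1 v.1.2 w) = 0 := S.inner_cross_self _ _ _
  rw [mem_perp]
  simp [unit, h]

/-- The complex structure `J w = [e₀, w]` on the fibre at `v`. -/
def J (v : T0 M) : Module.End ℝ (S.perp v) :=
  (S.cross v.1.1 (S.unit v)).restrict fun w _ => S.cross_mem_perp v w

theorem J_mul_J (v : T0 M) : S.J v * S.J v = -1 := by
  ext w
  change S.cross v.1.1 (S.unit v) (S.cross v.1.1 (S.unit v) w.1) = -w.1
  rw [cross_cross, inner_unit_unit, inner_unit_of_mem S v w.1 w.2]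
  simp

/-- The fibre at `v` of the bundle `I`, as a complex vector space with `√-1` acting as `J`. -/
def Fibre (v : T0 M) : Type := S.perp v

instance (v : T0 M) : AddCommGroup (S.Fibre v) :=
  inferInstanceAs (AddCommGroup (S.perp v))

instance (v : T0 M) : Module ℂ (S.Fibre v) :=
  letI : Module (Module.End ℝ (S.perp v)) (S.Fibre v) :=
    inferInstanceAs (Module (Module.End ℝ (S.perp v)) (S.perp v))
  Module.compHom (S.Fibre v) (Complex.lift ⟨S.J v, S.J_mul_J v⟩).toRingHom

/-- The vector of the tangent bundle of `M` underlying a vector of the bundle `I`. -/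
def toTangent (w : TotalSpace (Fin 3 → ℂ) S.Fibre) : TangentBundle (𝓡 7) M :=
  ⟨w.1.1.1, Subtype.val (p := fun u => u ∈ S.perp w.1) w.2⟩

/-- The topology of the total space of `I`, as a subspace of the pull-back to `T⁰(M)` of the
tangent bundle of `M`, which in turn is a subspace of `T⁰(M) × TM`. -/
instance : TopologicalSpace (TotalSpace (Fin 3 → ℂ) S.Fibre) :=
  TopologicalSpace.induced (fun w => (w.1, S.toTangent w)) inferInstance

theorem complex_smul_def (v : T0 M) (z : ℂ) (w : S.perp v) :
    (z • (show S.Fibre v from w) : S.Fibre v) = (z.re • w + z.im • S.J v w : S.perp v) := by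
  change (Complex.lift ⟨S.J v, S.J_mul_J v⟩ z) w = _
  simp [Module.algebraMap_end_apply]

end G2Structure

end

/-! ## Bundles with a complex volume form -/

/-! The stabilizer in G₂ of a unit imaginary octonion is SU(3), so the fibres of `I` carry a
canonical complex volume form. It is Ω(a, b, c) = λ(a, b, c) - i λ(Ja, b, c). Complex linearity in
the first argument comes from J² = -1. That Ω is alternating comes from λ(Ja, b, c) = λ(a, Jb, c)
for a, b, c orthogonal to e₀, a consequence of the octonion identity `phi0_cross0_left`. Ω vanishes
on no fibre, because its real part is λ and λ(a, b, [a, b]) = |a|²|b|² for orthogonal a, b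
(`exists_phi0_ne_zero`).

A continuous, nowhere zero Ω trivializes the determinant bundle, which kills c₁. In Čech terms, Ω(s
y) = Ω(s x) det(A x y) for two frames. On a finer cover Ω(s x) = exp(2πi h x) with `h x` continuous,
so b = f - (h y - h x) is a locally constant integral cochain with the same coboundary as f. The
cocycle m is therefore the coboundary of b (`IsFirstChernClass.eq_zero_of_volumeForm`). Conversely,
the choice f = h y - h x exhibits zero as a first Chern class, once local frames exist
(`exists_isComplexFrameOn`). -/

namespace IsComplexFrameOn

variable {X : Type*} {F : Type*} {E : X → Type*} [TopologicalSpace X]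
  [∀ x, AddCommGroup (E x)] [∀ x, Module ℂ (E x)] [TopologicalSpace (TotalSpace F E)] {n : ℕ}

theorem mono {U V : Set X} {s : Fin n → ∀ x, E x} (h : IsComplexFrameOn F V s) (hU : U ⊆ V) :
    IsComplexFrameOn F U s :=
  ⟨fun k => (h.continuousOn k).mono hU, fun x hx => h.linearIndependent x (hU hx),
    fun x hx => h.span_eq_top x (hU hx)⟩

/-- The basis of a fibre given by a frame. -/
noncomputable def basis {U : Set X} {s : Fin n → ∀ x, E x} (h : IsComplexFrameOn F U s) {x : X}
    (hx : x ∈ U) : Module.Basis (Fin n) ℂ (E x) :=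
  Module.Basis.mk (h.linearIndependent x hx) (h.span_eq_top x hx).ge

theorem coe_basis {U : Set X} {s : Fin n → ∀ x, E x} (h : IsComplexFrameOn F U s) {x : X}
    (hx : x ∈ U) : ⇑(h.basis hx) = fun k => s k x :=
  Module.Basis.coe_mk _ _

theorem alternating_ne_zero {U : Set X} {s : Fin n → ∀ x, E x} (h : IsComplexFrameOn F U s)
    {x : X} (hx : x ∈ U) {Ω : E x [⋀^Fin n]→ₗ[ℂ] ℂ} (hΩ : Ω ≠ 0) : Ω (fun k => s k x) ≠ 0 := by
  rw [← h.coe_basis hx]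
  exact fun h0 => hΩ ((AlternatingMap.map_basis_eq_zero_iff _ _).1 h0)

end IsComplexFrameOn

/-- A top-degree form is a multiple of the determinant in the basis `B`, and the columns of `A` are
the coordinates of the vectors `t b`. -/
theorem AlternatingMap.map_sum_smul {R V : Type*} [CommRing R] [AddCommGroup V] [Module R V]
    {n : ℕ} (B : Module.Basis (Fin n) R V) (Ω : V [⋀^Fin n]→ₗ[R] R)
    (A : Matrix (Fin n) (Fin n) R) (t : Fin n → V) (ht : ∀ b, t b = ∑ a, A a b • B a) :
    Ω t = Ω B * A.det := by
  have hA : B.toMatrix t = A := by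
    ext i j
    rw [Module.Basis.toMatrix_apply, ht, B.repr_sum_self]
  conv_lhs => rw [Ω.eq_smul_basis_det B]
  rw [AlternatingMap.smul_apply, Module.Basis.det_apply, hA, smul_eq_mul]

/-- Near `x` the quotient g / g x is close to 1, hence in the domain of continuity of the principal
logarithm; the constant log (g x) is then added back. -/
theorem exists_nhd_log {X : Type*} [TopologicalSpace X] {U : Set X} (hU : IsOpen U) {x : X}
    (hx : x ∈ U) {g : X → ℂ} (hg : ContinuousOn g U) (hg0 : ∀ p ∈ U, g p ≠ 0) :
    ∃ V ⊆ U, IsOpen V ∧ x ∈ V ∧ ∃ h : X → ℂ, ContinuousOn h V ∧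
      ∀ p ∈ V, g p = Complex.exp (2 * Real.pi * Complex.I * h p) := by
  have hgx : ContinuousOn (fun p => g p / g x) U := hg.div_const _
  refine ⟨U ∩ (fun p => g p / g x) ⁻¹' Complex.slitPlane, inter_subset_left,
    hgx.isOpen_inter_preimage hU Complex.isOpen_slitPlane, ⟨hx, ?_⟩,
    fun p => (Complex.log (g p / g x) + Complex.log (g x)) / (2 * Real.pi * Complex.I), ?_, ?_⟩
  · simp [div_self (hg0 x hx)]
  · exact (((hgx.mono inter_subset_left).clog fun p hp => hp.2).add continuousOn_const).div_const _
  · rintro p ⟨hp, -⟩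
    have h1 := hg0 x hx
    have h2 := hg0 p hp
    rw [mul_div_cancel₀ _ Complex.two_pi_I_ne_zero, Complex.exp_add,
      Complex.exp_log (div_ne_zero h2 h1), Complex.exp_log h1, div_mul_cancel₀ _ h1]

theorem continuousOn_int_of_cast {X : Type*} [TopologicalSpace X] {U : Set X} {b : X → ℤ}
    {f : X → ℂ} (hf : ContinuousOn f U) (hb : ∀ p ∈ U, (b p : ℂ) = f p) : ContinuousOn b U := by
  have h : ContinuousOn (fun p => (b p : ℂ)) U := hf.congr hb
  have h' : ContinuousOn (fun p => (b p : ℝ)) U :=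
    (Complex.continuous_re.comp_continuousOn h).congr fun p _ => by simp
  exact Int.isClosedEmbedding_coe_real.isInducing.continuousOn_iff.2 h'

section VolumeForm

variable {X : Type*} {F : Type*} {E : X → Type*} [TopologicalSpace X]
  [∀ x, AddCommGroup (E x)] [∀ x, Module ℂ (E x)] [TopologicalSpace (TotalSpace F E)] {n : ℕ}
  (Ω : ∀ x, E x [⋀^Fin n]→ₗ[ℂ] ℂ)

theorem IsFirstChernClass.eq_zero_of_volumeForm (hΩ : ∀ x, Ω x ≠ 0)
    (hc : ∀ (U : Set X) (s : Fin n → ∀ x, E x), IsOpen U → IsComplexFrameOn F U s →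
      ContinuousOn (fun x => Ω x fun k => s k x) U)
    {c : Cech.H2 X} (h : IsFirstChernClass F E n c) : c = 0 := by
  obtain ⟨U, s, A, f, m, hs, hA, hf, hdet, hm, rfl⟩ := h
  choose V hVU hVo hxV h hcont hexp using fun x =>
    exists_nhd_log (U.isOpen x) (U.mem x) (hc _ _ (U.isOpen x) (hs x))
      fun p hp => (hs x).alternating_ne_zero hp (hΩ p)
  -- The membership condition sits under the existential so that `choose` yields a cochain defined
  -- everywhere; off the intersection its value is irrelevant. On the intersection, the change of
  -- frame formula for Ω says that exp takes equal values at 2πi h y and 2πi (h x + f x y).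
  have key : ∀ x y p, ∃ k : ℤ, p ∈ V x ∩ V y → (k : ℂ) = f x y p - (h y p - h x p) := by
    intro x y p
    by_cases hp : p ∈ V x ∩ V y
    · have hpx := hVU x hp.1
      have hpy := hVU y hp.2
      have h1 := (Ω p).map_sum_smul ((hs x).basis hpx) (A x y p) (fun b => s y b p) (by
        simpa [(hs x).coe_basis hpx] using hA x y p ⟨hpx, hpy⟩)
      rw [(hs x).coe_basis hpx, hexp y p hp.2, hexp x p hp.1, hdet x y p ⟨hpx, hpy⟩,
        ← Complex.exp_add, Complex.exp_eq_exp_iff_exists_int] at h1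
      obtain ⟨k, hk⟩ := h1
      refine ⟨-k, fun _ => mul_left_cancel₀ Complex.two_pi_I_ne_zero ?_⟩
      push_cast
      linear_combination hk
    · exact ⟨0, fun h => absurd h hp⟩
  choose b hb using key
  refine (QuotientAddGroup.eq_zero_iff m).2 ⟨⟨V, hVo, hxV⟩, b, fun x y => ?_, fun x y z p hp => ?_⟩
  · refine continuousOn_int_of_cast (((hf x y).mono (inter_subset_inter (hVU x) (hVU y))).sub
      (((hcont y).mono inter_subset_right).sub ((hcont x).mono inter_subset_left))) ?_
    exact hb x y
  -- The differences h y - h x form a coboundary, so they cancel here and b has the same coboundary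
  -- as f, namely m.
  · have h1 := hm x y z p ⟨⟨hVU x hp.1.1, hVU y hp.1.2⟩, hVU z hp.2⟩
    have hxy := hb x y p hp.1
    have hyz := hb y z p ⟨hp.1.2, hp.2⟩
    have hxz := hb x z p ⟨hp.1.1, hp.2⟩
    apply Int.cast_injective (α := ℂ)
    simp only [Cech.d1] at h1 ⊢
    push_cast
    rw [h1, hxy, hyz, hxz]
    ring

theorem isFirstChernClass_zero_of_volumeForm (hΩ : ∀ x, Ω x ≠ 0)
    (hc : ∀ (U : Set X) (s : Fin n → ∀ x, E x), IsOpen U → IsComplexFrameOn F U s →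
      ContinuousOn (fun x => Ω x fun k => s k x) U)
    (hloc : ∀ x : X, ∃ (U : Set X) (s : Fin n → ∀ x, E x), IsOpen U ∧ x ∈ U ∧
      IsComplexFrameOn F U s) :
    IsFirstChernClass F E n (0 : Cech.H2 X) := by
  classical
  choose U s hUo hxU hs using hloc
  choose V hVU hVo hxV h hcont hexp using fun x =>
    exists_nhd_log (hUo x) (hxU x) (hc _ _ (hUo x) (hs x))
      fun p hp => (hs x).alternating_ne_zero hp (hΩ p)
  have hA : ∀ x y p, ∃ A : Matrix (Fin n) (Fin n) ℂ, p ∈ V x ∩ V y →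
      ∀ b, s y b p = ∑ a, A a b • s x a p := by
    intro x y p
    by_cases hp : p ∈ V x ∩ V y
    · refine ⟨((hs x).basis (hVU x hp.1)).toMatrix fun b => s y b p, fun _ b => ?_⟩
      have h1 := ((hs x).basis (hVU x hp.1)).sum_toMatrix_smul_self (fun b => s y b p) b
      rw [← h1]
      simp [(hs x).coe_basis]
    · exact ⟨0, fun h => absurd h hp⟩
  choose A hA using hA
  -- With f itself the coboundary of h, the associated integral cocycle is identically zero.
  refine ⟨⟨V, hVo, hxV⟩, s, A, fun x y p => h y p - h x p, 0, fun x => (hs x).mono (hVU x), hA,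
    fun x y => ((hcont y).mono inter_subset_right).sub ((hcont x).mono inter_subset_left), ?_, ?_,
    rfl⟩
  · intro x y p hp
    have hpx := hVU x hp.1
    have h1 := (Ω p).map_sum_smul ((hs x).basis hpx) (A x y p) (fun b => s y b p) (by
      simpa [(hs x).coe_basis hpx] using hA x y p hp)
    rw [(hs x).coe_basis hpx, hexp y p hp.2, hexp x p hp.1] at h1
    rw [mul_sub, Complex.exp_sub, h1, mul_div_cancel_left₀ _ (Complex.exp_ne_zero _)]
  · intro x y z p _
    simp [Cech.d1]

end VolumeForm

/-! ## Continuity of the vector product -/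

/-- Cramer's rule: near `p₀` the solution is (det A)⁻¹ adj(A) l, which is continuous in A and l. -/
theorem continuousAt_of_mulVec {P n : Type*} [TopologicalSpace P] [Fintype n] [DecidableEq n]
    {A : P → Matrix n n ℝ} {c l : P → n → ℝ} {p₀ : P} (hA : ContinuousAt A p₀)
    (hl : ContinuousAt l p₀) (hdet : (A p₀).det ≠ 0) (h : ∀ᶠ p in nhds p₀, (A p).mulVec (c p) = l p) :
    ContinuousAt c p₀ := by
  have hd : ContinuousAt (fun p => (A p).det) p₀ :=
    (continuous_id.matrix_det.continuousAt (x := A p₀)).comp hA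
  have ha : ContinuousAt (fun p => (A p).adjugate) p₀ :=
    (continuous_id.matrix_adjugate.continuousAt (x := A p₀)).comp hA
  have hal : ContinuousAt (fun p => (A p).adjugate.mulVec (l p)) p₀ :=
    ContinuousAt.comp (f := fun p => ((A p).adjugate, l p))
      (g := fun q : Matrix n n ℝ × (n → ℝ) => q.1.mulVec q.2)
      (continuous_fst.matrix_mulVec continuous_snd).continuousAt (ha.prodMk hl)
  refine ((hd.inv₀ hdet).smul hal).congr ?_
  filter_upwards [h, hd.eventually_ne hdet] with p hp hp'
  change (A p).det⁻¹ • (A p).adjugate.mulVec (l p) = c p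
  rw [← hp, Matrix.mulVec_mulVec, Matrix.adjugate_mul, Matrix.smul_mulVec, Matrix.one_mulVec]
  exact inv_smul_smul₀ hp' _

section TangentCoordinates

variable {M : Type*} [TopologicalSpace M] [ChartedSpace E7 M] [IsManifold (𝓡 7) ∞ M]

/-- The coordinates at `x₀` of tangent vectors at points near `x₀`. -/
noncomputable def tangentCoord (x₀ x : M) : TangentSpace (𝓡 7) x →ₗ[ℝ] E7 :=
  (trivializationAt E7 (TangentSpace (𝓡 7)) x₀).linearMapAt ℝ x

/-- The coordinate vector fields near `x₀`. -/
noncomputable def tangentFrame (x₀ : M) (i : Fin 7) (x : M) : TangentSpace (𝓡 7) x :=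
  (trivializationAt E7 (TangentSpace (𝓡 7)) x₀).symm x (EuclideanSpace.single i 1)

theorem sum_smul_tangentFrame {x₀ x : M}
    (hx : x ∈ (trivializationAt E7 (TangentSpace (𝓡 7)) x₀).baseSet) (c : E7) :
    ∑ i, c i • tangentFrame x₀ i x =
      (trivializationAt E7 (TangentSpace (𝓡 7)) x₀).symmₗ ℝ x c := by
  conv_rhs => rw [← (EuclideanSpace.basisFun (Fin 7) ℝ).sum_repr c, map_sum]
  refine Finset.sum_congr rfl fun i _ => ?_
  rw [map_smul, EuclideanSpace.basisFun_repr, EuclideanSpace.basisFun_apply,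
    Bundle.Trivialization.symmₗ_apply _ hx]
  rfl

theorem sum_tangentCoord_smul {x₀ x : M}
    (hx : x ∈ (trivializationAt E7 (TangentSpace (𝓡 7)) x₀).baseSet) (w : TangentSpace (𝓡 7) x) :
    ∑ i, tangentCoord x₀ x w i • tangentFrame x₀ i x = w :=
  (sum_smul_tangentFrame hx _).trans (Bundle.Trivialization.symmₗ_linearMapAt _ hx w)

theorem tangentCoord_sum_smul {x₀ x : M}
    (hx : x ∈ (trivializationAt E7 (TangentSpace (𝓡 7)) x₀).baseSet) (c : E7) :
    tangentCoord x₀ x (∑ i, c i • tangentFrame x₀ i x) = c := by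
  rw [sum_smul_tangentFrame hx]
  exact Bundle.Trivialization.linearMapAt_symmₗ _ hx c

variable {P : Type*} [TopologicalSpace P] {x : P → M} {p₀ : P}

theorem eventually_mem_baseSet (hx : ContinuousAt x p₀) :
    ∀ᶠ p in nhds p₀, x p ∈ (trivializationAt E7 (TangentSpace (𝓡 7)) (x p₀)).baseSet :=
  hx.eventually ((trivializationAt E7 (TangentSpace (𝓡 7)) (x p₀)).open_baseSet.mem_nhds
    (mem_baseSet_trivializationAt _ _ _))

theorem continuousAt_tangent_iff {a : ∀ p, TangentSpace (𝓡 7) (x p)} :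
    ContinuousAt (fun p => (⟨x p, a p⟩ : TangentBundle (𝓡 7) M)) p₀ ↔
      ContinuousAt x p₀ ∧ ContinuousAt (fun p => tangentCoord (x p₀) (x p) (a p)) p₀ := by
  rw [FiberBundle.continuousAt_totalSpace]
  refine and_congr_right fun hx => continuousAt_congr ?_
  filter_upwards [eventually_mem_baseSet hx] with p hp
  simp only [tangentCoord, Bundle.Trivialization.linearMapAt_apply]
  rw [if_pos hp]

theorem continuousAt_tangentFrame (hx : ContinuousAt x p₀) {x₀ : M}
    (h₀ : x p₀ ∈ (trivializationAt E7 (TangentSpace (𝓡 7)) x₀).baseSet) (c : E7) :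
    ContinuousAt (fun p => (⟨x p, (trivializationAt E7 (TangentSpace (𝓡 7)) x₀).symm (x p) c⟩ :
      TangentBundle (𝓡 7) M)) p₀ := by
  set t := trivializationAt E7 (TangentSpace (𝓡 7)) x₀
  have h1 : ContinuousAt (fun z : M × E7 => (⟨z.1, t.symm z.1 z.2⟩ : TangentBundle (𝓡 7) M))
      (x p₀, c) :=
    t.continuousOn_symm.continuousAt ((t.open_baseSet.prod isOpen_univ).mem_nhds ⟨h₀, mem_univ _⟩)
  exact ContinuousAt.comp (f := fun p => (x p, c)) h1 (hx.prodMk continuousAt_const)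

end TangentCoordinates

namespace G2Structure

variable {M : Type*} [TopologicalSpace M] [ChartedSpace E7 M] [IsManifold (𝓡 7) ∞ M]
  (S : G2Structure M) {P : Type*} [TopologicalSpace P] {x : P → M} {p₀ : P}
  {a b c : ∀ p, TangentSpace (𝓡 7) (x p)}

theorem continuousAt_metric
    (ha : ContinuousAt (fun p => (⟨x p, a p⟩ : TangentBundle (𝓡 7) M)) p₀)
    (hb : ContinuousAt (fun p => (⟨x p, b p⟩ : TangentBundle (𝓡 7) M)) p₀) :
    ContinuousAt (fun p => S.metric.inner (x p) (a p) (b p)) p₀ := by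
  have hx : ContinuousAt x p₀ := (continuousAt_tangent_iff.1 ha).1
  have hm : ContinuousAt (fun p => TotalSpace.mk' (E7 →L[ℝ] E7 →L[ℝ] ℝ)
      (E := fun y : M => TangentSpace (𝓡 7) y →L[ℝ] TangentSpace (𝓡 7) y →L[ℝ] ℝ)
      (x p) (S.metric.inner (x p))) p₀ :=
    ContinuousAt.comp (f := x) S.metric.contMDiff.continuous.continuousAt hx
  have h := ContinuousAt.clm_bundle_apply₂ (E₃ := Bundle.Trivial M ℝ) (F₃ := ℝ) hm ha hb
  exact ((FiberBundle.continuousAt_totalSpace ℝ _).1 h).2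

/-- By trilinearity the value is a finite sum of products of the coordinates of the three vectors
with the components of the form in the coordinate frame, all of which are continuous. -/
theorem continuousAt_form
    (ha : ContinuousAt (fun p => (⟨x p, a p⟩ : TangentBundle (𝓡 7) M)) p₀)
    (hb : ContinuousAt (fun p => (⟨x p, b p⟩ : TangentBundle (𝓡 7) M)) p₀)
    (hc : ContinuousAt (fun p => (⟨x p, c p⟩ : TangentBundle (𝓡 7) M)) p₀) :
    ContinuousAt (fun p => S.form (x p) (a p) (b p) (c p)) p₀ := by
  obtain ⟨hx, ha⟩ := continuousAt_tangent_iff.1 ha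
  have hb := (continuousAt_tangent_iff.1 hb).2
  have hc := (continuousAt_tangent_iff.1 hc).2
  have hi : ∀ {f : P → E7}, ContinuousAt f p₀ → ∀ i, ContinuousAt (fun p => f p i) p₀ :=
    fun hf i => ContinuousAt.comp (g := fun y : E7 => y i) (by fun_prop) hf
  have hF : ∀ i j k, ContinuousAt (fun p => S.form (x p) (tangentFrame (x p₀) i (x p))
      (tangentFrame (x p₀) j (x p)) (tangentFrame (x p₀) k (x p))) p₀ := fun i j k =>
    ContinuousAt.comp (f := x) ((S.contMDiffOn_form (x p₀) (EuclideanSpace.single i 1)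
      (EuclideanSpace.single j 1) (EuclideanSpace.single k 1)).continuousOn.continuousAt
      ((trivializationAt E7 (TangentSpace (𝓡 7)) (x p₀)).open_baseSet.mem_nhds
        (mem_baseSet_trivializationAt _ _ _))) hx
  have key : ContinuousAt (fun p => ∑ i, ∑ j, ∑ k, tangentCoord (x p₀) (x p) (a p) i *
      (tangentCoord (x p₀) (x p) (b p) j * (tangentCoord (x p₀) (x p) (c p) k *
        S.form (x p) (tangentFrame (x p₀) i (x p))
          (tangentFrame (x p₀) j (x p)) (tangentFrame (x p₀) k (x p))))) p₀ :=
    tendsto_finsetSum _ fun i _ => tendsto_finsetSum _ fun j _ => tendsto_finsetSum _ fun k _ =>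
      (hi ha i).mul ((hi hb j).mul ((hi hc k).mul (hF i j k)))
  refine key.congr ?_
  filter_upwards [eventually_mem_baseSet hx] with p hp
  conv_rhs => rw [← sum_tangentCoord_smul hp (a p), ← sum_tangentCoord_smul hp (b p),
    ← sum_tangentCoord_smul hp (c p)]
  simp only [map_sum, map_smul, LinearMap.sum_apply, LinearMap.smul_apply, smul_eq_mul,
    Finset.mul_sum]
  -- Expansion by linearity puts the sum over `k` outermost and that over `i` innermost; three
  -- interchanges bring the other side into this order.
  rw [Finset.sum_comm]
  simp_rw [fun j => Finset.sum_comm (s := Finset.univ) (t := Finset.univ) (f := fun (i k : Fin 7) =>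
    tangentCoord (x p₀) (x p) (a p) i * (tangentCoord (x p₀) (x p) (b p) j *
      (tangentCoord (x p₀) (x p) (c p) k * S.form (x p) (tangentFrame (x p₀) i (x p))
          (tangentFrame (x p₀) j (x p)) (tangentFrame (x p₀) k (x p)))))]
  rw [Finset.sum_comm]
  refine Finset.sum_congr rfl fun k _ => Finset.sum_congr rfl fun j _ =>
    Finset.sum_congr rfl fun i _ => ?_
  ring

theorem eq_zero_of_inner_eq_zero {y : M} {u : TangentSpace (𝓡 7) y}
    (h : ∀ v, S.metric.inner y v u = 0) : u = 0 := by
  by_contra h0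
  exact (S.metric.pos y u h0).ne' (h u)

/-- The vector product is given only implicitly, by its inner products. Its coordinates solve a
linear system whose matrix is the Gram matrix of the coordinate frame and whose right-hand side
consists of values of the 3-form. -/
theorem continuousAt_cross
    (ha : ContinuousAt (fun p => (⟨x p, a p⟩ : TangentBundle (𝓡 7) M)) p₀)
    (hb : ContinuousAt (fun p => (⟨x p, b p⟩ : TangentBundle (𝓡 7) M)) p₀) :
    ContinuousAt (fun p => (⟨x p, S.cross (x p) (a p) (b p)⟩ : TangentBundle (𝓡 7) M)) p₀ := by
  have hx : ContinuousAt x p₀ := (continuousAt_tangent_iff.1 ha).1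
  have hF := fun i => continuousAt_tangentFrame hx (mem_baseSet_trivializationAt E7
    (TangentSpace (𝓡 7)) (x p₀)) (EuclideanSpace.single i 1)
  refine continuousAt_tangent_iff.2 ⟨hx, ?_⟩
  have key := continuousAt_of_mulVec (P := P) (p₀ := p₀)
    (A := fun p => Matrix.of fun i j => S.metric.inner (x p) (tangentFrame (x p₀) i (x p))
      (tangentFrame (x p₀) j (x p)))
    (c := fun p => (tangentCoord (x p₀) (x p) (S.cross (x p) (a p) (b p))).ofLp)
    (l := fun p i => S.form (x p) (a p) (b p) (tangentFrame (x p₀) i (x p)))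
    (continuousAt_pi.2 fun i => continuousAt_pi.2 fun j => S.continuousAt_metric (hF i) (hF j))
    (continuousAt_pi.2 fun i => S.continuousAt_form ha hb (hF i)) ?_ ?_
  · exact ContinuousAt.comp (g := WithLp.toLp 2) (PiLp.continuous_toLp 2 _).continuousAt key
  -- A kernel vector of the Gram matrix gives a tangent vector orthogonal to the whole frame. That
  -- vector is zero, and so are its coordinates.
  · intro h0
    obtain ⟨v, hv0, hv⟩ := Matrix.exists_mulVec_eq_zero_iff.2 h0
    have hp := mem_baseSet_trivializationAt E7 (TangentSpace (𝓡 7)) (x p₀)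
    have hu : ∑ j, (WithLp.toLp 2 v : E7) j • tangentFrame (x p₀) j (x p₀) = 0 := by
      refine S.eq_zero_of_inner_eq_zero fun w => ?_
      have hv' : ∀ i, S.metric.inner (x p₀) (tangentFrame (x p₀) i (x p₀))
          (∑ j, (WithLp.toLp 2 v : E7) j • tangentFrame (x p₀) j (x p₀)) = 0 := fun i => by
        simpa [Matrix.mulVec, dotProduct, mul_comm] using congrFun hv i
      rw [S.metric.symm, ← sum_tangentCoord_smul hp w, map_sum]
      refine Finset.sum_eq_zero fun i _ => ?_
      rw [map_smul, S.metric.symm, hv', smul_zero]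
    have hv1 := tangentCoord_sum_smul hp (WithLp.toLp 2 v)
    rw [hu, map_zero] at hv1
    exact hv0 (congrArg WithLp.ofLp hv1).symm
  · filter_upwards [eventually_mem_baseSet hx] with p hp
    funext i
    rw [← S.inner_cross, S.metric.symm]
    conv_rhs => rw [← sum_tangentCoord_smul hp (S.cross (x p) (a p) (b p))]
    simp [Matrix.mulVec, dotProduct, mul_comm]

end G2Structure

/-! ## The complex volume form -/

/-- The inner product terms vanish when a, b, c are orthogonal to u, so that multiplication by u can
be moved from one argument of the 3-form to the next. -/
theorem phi0_cross0_left (u a b c : E7) :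
    phi0 (cross0 u a) b c = phi0 a (cross0 u b) c + inner ℝ u a * inner ℝ b c +
      inner ℝ u b * inner ℝ a c - 2 * inner ℝ u c * inner ℝ a b := by
  simp only [phi0, inner_E7]
  simp [cross0]
  ring

theorem phi0_swap (a b c : E7) : phi0 b a c = -phi0 a b c := by
  simp [phi0, inner_E7, cross0]
  ring

theorem phi0_rotate (a b c : E7) : phi0 b c a = phi0 a b c := by
  simp [phi0, inner_E7, cross0]
  ring

theorem phi0_cross0_self (a b : E7) :
    phi0 a b (cross0 a b) = inner ℝ a a * inner ℝ b b - inner ℝ a b ^ 2 := by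
  simp only [phi0, inner_E7]
  simp [cross0]
  ring

theorem exists_ne_zero_orthogonal_three (f : Fin 3 → E7) :
    ∃ b : E7, b ≠ 0 ∧ ∀ i, inner ℝ (f i) b = 0 := by
  let L : E7 →ₗ[ℝ] Fin 3 → ℝ := LinearMap.pi fun i => (innerSL ℝ (f i)).toLinearMap
  have hL : LinearMap.ker L ≠ ⊥ := LinearMap.ker_ne_bot_of_finrank_lt (by simp)
  obtain ⟨b, hb, hb0⟩ := Submodule.exists_mem_ne_zero_of_ne_bot hL
  exact ⟨b, hb0, fun i => congrFun hb i⟩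

/-- Take nonzero a ⟂ u, nonzero b ⟂ u, a, u × a, and then a × b as third vector. It is orthogonal to
u since (u, a × b) = (u × a, b) = 0, and the 3-form takes the value |a|²|b|². -/
theorem exists_phi0_ne_zero (u : E7) : ∃ a : Fin 3 → E7, (∀ i, inner ℝ u (a i) = 0) ∧
    phi0 (a 0) (a 1) (a 2) ≠ 0 := by
  obtain ⟨a, ha0, ha⟩ := exists_ne_zero_orthogonal_three fun _ => u
  obtain ⟨b, hb0, hb⟩ := exists_ne_zero_orthogonal_three ![u, a, cross0 u a]
  have hub : inner ℝ u b = 0 := hb 0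
  have hab : inner ℝ a b = 0 := hb 1
  have huab : inner ℝ u (cross0 a b) = 0 := by
    rw [real_inner_comm]
    exact (phi0_rotate u a b).trans (hb 2)
  refine ⟨![a, b, cross0 a b], fun i => ?_, ?_⟩
  · fin_cases i
    exacts [ha 0, hub, huab]
  · change phi0 a b (cross0 a b) ≠ 0
    rw [phi0_cross0_self, hab]
    simp [ha0, hb0]

namespace G2Structure

variable {M : Type*} [TopologicalSpace M] [ChartedSpace E7 M] [IsManifold (𝓡 7) ∞ M]
  (S : G2Structure M)

theorem map_cross {y : M} {e : TangentSpace (𝓡 7) y ≃L[ℝ] E7}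
    (he : ∀ u v, S.metric.inner y u v = inner ℝ (e u) (e v))
    (hf : ∀ u v w, S.form y u v w = phi0 (e u) (e v) (e w)) (a b : TangentSpace (𝓡 7) y) :
    e (S.cross y a b) = cross0 (e a) (e b) := by
  refine ext_inner_right ℝ fun w => ?_
  obtain ⟨w, rfl⟩ := e.surjective w
  rw [← he, inner_cross, hf, phi0]

theorem form_swap (y : M) (a b c : TangentSpace (𝓡 7) y) :
    S.form y b a c = -S.form y a b c := by
  obtain ⟨e, -, hf⟩ := S.exists_model y
  rw [hf, hf, phi0_swap]

theorem form_rotate (y : M) (a b c : TangentSpace (𝓡 7) y) :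
    S.form y b c a = S.form y a b c := by
  obtain ⟨e, -, hf⟩ := S.exists_model y
  rw [hf, hf, phi0_rotate]

theorem form_cross_left (y : M) (u a b c : TangentSpace (𝓡 7) y)
    (ha : S.metric.inner y u a = 0) (hb : S.metric.inner y u b = 0)
    (hc : S.metric.inner y u c = 0) :
    S.form y (S.cross y u a) b c = S.form y a (S.cross y u b) c := by
  obtain ⟨e, he, hf⟩ := S.exists_model y
  rw [he] at ha hb hc
  rw [hf, hf, S.map_cross he hf, S.map_cross he hf, phi0_cross0_left, ha, hb, hc]
  ring

/-- The inclusion of a fibre of `I` into the tangent space of `M`. -/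
noncomputable def fibreVal (v : T0 M) : S.Fibre v →+ TangentSpace (𝓡 7) v.1.1 :=
  (S.perp v).subtype.toAddMonoidHom

theorem fibreVal_smul (v : T0 M) (z : ℂ) (w : S.Fibre v) : S.fibreVal v (z • w) =
    z.re • S.fibreVal v w + z.im • S.cross v.1.1 (S.unit v) (S.fibreVal v w) :=
  congrArg Subtype.val (S.complex_smul_def v z w)

theorem inner_unit_fibreVal (v : T0 M) (w : S.Fibre v) :
    S.metric.inner v.1.1 (S.unit v) (S.fibreVal v w) = 0 :=
  S.inner_unit_of_mem v _ (Subtype.property (p := fun u => u ∈ S.perp v) w)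

/-- The fibre of `I` as a real vector space. -/
noncomputable def fibreEquiv (v : T0 M) : S.Fibre v ≃ₗ[ℝ] S.perp v where
  toFun w := w
  invFun w := w
  map_add' _ _ := rfl
  map_smul' r w := by
    apply Subtype.ext
    refine (S.fibreVal_smul v (r : ℂ) w).trans ?_
    rw [Complex.ofReal_re, Complex.ofReal_im, zero_smul, add_zero]
    rfl
  left_inv _ := rfl
  right_inv _ := rfl

theorem finrank_perp (v : T0 M) : Module.finrank ℝ (S.perp v) = 6 := by
  have h : S.bilin v.1.1 v.1.2 ≠ 0 := fun h =>
    (S.metric.pos v.1.1 v.1.2 v.2).ne' (LinearMap.congr_fun h v.1.2)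
  have h1 := Module.Dual.finrank_ker_add_one_of_ne_zero (f := S.bilin v.1.1 v.1.2) h
  have h2 : Module.finrank ℝ (TangentSpace (𝓡 7) v.1.1) = 7 :=
    finrank_euclideanSpace_fin (𝕜 := ℝ) (n := 7)
  rw [h2] at h1
  exact Nat.succ_injective h1

/-- The real dimension 6 is twice the complex one. This makes any three independent vectors of a
fibre a basis. -/
theorem finrank_fibre (v : T0 M) : Module.finrank ℂ (S.Fibre v) = 3 := by
  have h := (S.fibreEquiv v).finrank_eq
  rw [S.finrank_perp, finrank_real_of_complex] at h
  omega

/-- The complex volume form as a function of three vectors of a fibre. -/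
noncomputable def vol (v : T0 M) (a b c : S.Fibre v) : ℂ :=
  S.form v.1.1 (S.fibreVal v a) (S.fibreVal v b) (S.fibreVal v c) -
    Complex.I * S.form v.1.1 (S.cross v.1.1 (S.unit v) (S.fibreVal v a)) (S.fibreVal v b)
      (S.fibreVal v c)

theorem vol_add (v : T0 M) (a a' b c : S.Fibre v) :
    S.vol v (a + a') b c = S.vol v a b c + S.vol v a' b c := by
  simp only [vol, map_add, LinearMap.add_apply, Complex.ofReal_add]
  ring

/-- Since J² = -1 on the orthogonal complement of e₀, replacing a by Ja exchanges the two terms of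
`vol` up to the factor i; the sign of the imaginary part is chosen for this. -/
theorem vol_smul (v : T0 M) (z : ℂ) (a b c : S.Fibre v) :
    S.vol v (z • a) b c = z * S.vol v a b c := by
  have h := S.cross_cross v.1.1 (S.unit v) (S.fibreVal v a)
  rw [S.inner_unit_unit, S.inner_unit_fibreVal, zero_smul, add_zero, neg_one_smul] at h
  simp only [vol, fibreVal_smul, map_add, map_smul, h, LinearMap.add_apply, LinearMap.smul_apply,
    map_neg, LinearMap.neg_apply, smul_eq_mul, smul_neg]
  conv_rhs => rw [← Complex.re_add_im z]
  push_cast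
  linear_combination ((z.im : ℂ) * (S.form v.1.1
    (S.cross v.1.1 (S.unit v) (S.fibreVal v a)) (S.fibreVal v b) (S.fibreVal v c))) *
    Complex.I_sq

/-- The real part is antisymmetric because λ is; for the imaginary part, J is first moved from one
argument to the other by `form_cross_left`. -/
theorem vol_swap (v : T0 M) (a b c : S.Fibre v) : S.vol v b a c = -S.vol v a b c := by
  rw [vol, vol, S.form_cross_left _ _ _ _ _ (S.inner_unit_fibreVal v b)
    (S.inner_unit_fibreVal v a) (S.inner_unit_fibreVal v c), S.form_swap,
    S.form_swap _ (S.cross _ _ _)]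
  push_cast
  ring

theorem vol_rotate (v : T0 M) (a b c : S.Fibre v) : S.vol v b c a = S.vol v a b c := by
  rw [vol, vol, S.form_cross_left _ _ _ _ _ (S.inner_unit_fibreVal v a)
    (S.inner_unit_fibreVal v b) (S.inner_unit_fibreVal v c),
    S.form_rotate _ (S.fibreVal v a) (S.fibreVal v b),
    S.form_rotate _ (S.fibreVal v a) (S.cross _ _ _)]

theorem vol_self (v : T0 M) (a c : S.Fibre v) : S.vol v a a c = 0 :=
  self_eq_neg.1 (S.vol_swap v a a c)

/-- The complex volume form on the fibres of `I`. -/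
noncomputable def volumeForm (v : T0 M) : S.Fibre v [⋀^Fin 3]→ₗ[ℂ] ℂ where
  toFun w := S.vol v (w 0) (w 1) (w 2)
  map_update_add' {inst} w i a a' := by
    -- The field allows any decidability instance; with the standard one the updates reduce by
    -- computation. Linearity in the other two arguments is then carried over from the first by
    -- rotation.
    obtain rfl : inst = instDecidableEqFin 3 := Subsingleton.elim _ _
    fin_cases i
    · exact S.vol_add v a a' (w 1) (w 2)
    · change S.vol v (w 0) (a + a') (w 2) = S.vol v (w 0) a (w 2) + S.vol v (w 0) a' (w 2)
      rw [← S.vol_rotate v _ a, ← S.vol_rotate v _ a', ← S.vol_rotate, vol_add]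
    · change S.vol v (w 0) (w 1) (a + a') = S.vol v (w 0) (w 1) a + S.vol v (w 0) (w 1) a'
      rw [S.vol_rotate v (a + a'), S.vol_rotate v a, S.vol_rotate v a', vol_add]
  map_update_smul' {inst} w i z a := by
    obtain rfl : inst = instDecidableEqFin 3 := Subsingleton.elim _ _
    fin_cases i
    · exact S.vol_smul v z a (w 1) (w 2)
    · change S.vol v (w 0) (z • a) (w 2) = z * S.vol v (w 0) a (w 2)
      rw [← S.vol_rotate v _ a, ← S.vol_rotate, vol_smul]
    · change S.vol v (w 0) (w 1) (z • a) = z * S.vol v (w 0) (w 1) a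
      rw [S.vol_rotate v (z • a), S.vol_rotate v a, vol_smul]
  map_eq_zero_of_eq' w i j h hij := by
    have h01 : w 0 = w 1 → S.vol v (w 0) (w 1) (w 2) = 0 := fun h => by rw [h, vol_self]
    have h12 : w 1 = w 2 → S.vol v (w 0) (w 1) (w 2) = 0 := fun h => by
      rw [h, ← vol_rotate, vol_self]
    have h02 : w 0 = w 2 → S.vol v (w 0) (w 1) (w 2) = 0 := fun h => by
      rw [h, vol_rotate, vol_self]
    fin_cases i <;> fin_cases j
    exacts [absurd rfl hij, h01 h, h02 h, h01 h.symm, absurd rfl hij, h12 h, h02 h.symm,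
      h12 h.symm, absurd rfl hij]

theorem volumeForm_apply (v : T0 M) (w : Fin 3 → S.Fibre v) :
    S.volumeForm v w = S.vol v (w 0) (w 1) (w 2) := rfl

theorem vol_ne_zero {v : T0 M} {a b c : S.Fibre v}
    (h : S.form v.1.1 (S.fibreVal v a) (S.fibreVal v b) (S.fibreVal v c) ≠ 0) :
    S.vol v a b c ≠ 0 := fun h0 => h (by simpa [vol] using congrArg Complex.re h0)

theorem exists_form_ne_zero (v : T0 M) : ∃ a : Fin 3 → S.Fibre v,
    S.form v.1.1 (S.fibreVal v (a 0)) (S.fibreVal v (a 1)) (S.fibreVal v (a 2)) ≠ 0 := by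
  obtain ⟨e, he, hf⟩ := S.exists_model v.1.1
  obtain ⟨a, ha, h⟩ := exists_phi0_ne_zero (e v.1.2)
  have hm : ∀ i, e.symm (a i) ∈ S.perp v := fun i => by
    rw [mem_perp, he, e.apply_symm_apply, ha]
  refine ⟨fun i => (⟨e.symm (a i), hm i⟩ : S.perp v), ?_⟩
  change S.form v.1.1 (e.symm (a 0)) (e.symm (a 1)) (e.symm (a 2)) ≠ 0
  rwa [hf, e.apply_symm_apply, e.apply_symm_apply, e.apply_symm_apply]

theorem volumeForm_ne_zero (v : T0 M) : S.volumeForm v ≠ 0 := by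
  obtain ⟨a, ha⟩ := S.exists_form_ne_zero v
  intro h
  exact S.vol_ne_zero ha (DFunLike.congr_fun h a)

end G2Structure

/-! ## Continuity of the volume form and local frames -/

section TangentSections

variable {M : Type*} [TopologicalSpace M] [ChartedSpace E7 M] [IsManifold (𝓡 7) ∞ M]
  {P : Type*} [TopologicalSpace P] {x : P → M} {p₀ : P} {a b : ∀ p, TangentSpace (𝓡 7) (x p)}

theorem ContinuousAt.smul_tangent {f : P → ℝ} (hf : ContinuousAt f p₀)
    (ha : ContinuousAt (fun p => (⟨x p, a p⟩ : TangentBundle (𝓡 7) M)) p₀) :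
    ContinuousAt (fun p => (⟨x p, f p • a p⟩ : TangentBundle (𝓡 7) M)) p₀ := by
  rw [continuousAt_tangent_iff] at ha ⊢
  simp only [map_smul]
  exact ⟨ha.1, hf.smul ha.2⟩

theorem ContinuousAt.sub_tangent
    (ha : ContinuousAt (fun p => (⟨x p, a p⟩ : TangentBundle (𝓡 7) M)) p₀)
    (hb : ContinuousAt (fun p => (⟨x p, b p⟩ : TangentBundle (𝓡 7) M)) p₀) :
    ContinuousAt (fun p => (⟨x p, a p - b p⟩ : TangentBundle (𝓡 7) M)) p₀ := by
  rw [continuousAt_tangent_iff] at ha hb ⊢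
  simp only [map_sub]
  exact ⟨ha.1, ha.2.sub hb.2⟩

end TangentSections

namespace G2Structure

variable {M : Type*} [TopologicalSpace M] [ChartedSpace E7 M] [IsManifold (𝓡 7) ∞ M]
  (S : G2Structure M)

/-- The topology of `I` is induced from T⁰(M) × TM, and the first component of a section is the
identity. -/
theorem continuousAt_fibre_iff {w : ∀ v, S.Fibre v} {v : T0 M} :
    ContinuousAt (fun v => TotalSpace.mk' (Fin 3 → ℂ) v (w v)) v ↔
      ContinuousAt (fun v : T0 M => (⟨v.1.1, S.fibreVal v (w v)⟩ : TangentBundle (𝓡 7) M)) v := by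
  have hi : Topology.IsInducing
      (fun w : TotalSpace (Fin 3 → ℂ) S.Fibre => (w.1, S.toTangent w)) := ⟨rfl⟩
  rw [hi.continuousAt_iff]
  exact ⟨fun h => h.snd, fun h => continuousAt_id.prodMk h⟩

theorem continuousAt_unit (v : T0 M) :
    ContinuousAt (fun v : T0 M => (⟨v.1.1, S.unit v⟩ : TangentBundle (𝓡 7) M)) v := by
  have h : ContinuousAt (fun v : T0 M => (⟨v.1.1, v.1.2⟩ : TangentBundle (𝓡 7) M)) v :=
    continuous_subtype_val.continuousAt
  exact ((S.continuousAt_metric h h).sqrt.inv₀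
    (Real.sqrt_pos.2 (S.metric.pos v.1.1 v.1.2 v.2)).ne').smul_tangent h

theorem continuousAt_vol {a b c : ∀ v, S.Fibre v} {v : T0 M}
    (ha : ContinuousAt (fun v => TotalSpace.mk' (Fin 3 → ℂ) v (a v)) v)
    (hb : ContinuousAt (fun v => TotalSpace.mk' (Fin 3 → ℂ) v (b v)) v)
    (hc : ContinuousAt (fun v => TotalSpace.mk' (Fin 3 → ℂ) v (c v)) v) :
    ContinuousAt (fun v => S.vol v (a v) (b v) (c v)) v := by
  rw [continuousAt_fibre_iff] at ha hb hc
  have h1 := S.continuousAt_form ha hb hc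
  have h2 := S.continuousAt_form (S.continuousAt_cross (S.continuousAt_unit v) ha) hb hc
  exact (Complex.continuous_ofReal.continuousAt.comp h1).sub
    (continuousAt_const.mul (Complex.continuous_ofReal.continuousAt.comp h2))

theorem continuousOn_volumeForm {U : Set (T0 M)} (hU : IsOpen U) {s : Fin 3 → ∀ v, S.Fibre v}
    (hs : ∀ k, ContinuousOn (fun v => TotalSpace.mk' (Fin 3 → ℂ) v (s k v)) U) :
    ContinuousOn (fun v => S.volumeForm v fun k => s k v) U := fun _ hv =>
  have h := fun k => (hs k).continuousAt (hU.mem_nhds hv)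
  (S.continuousAt_vol (h 0) (h 1) (h 2)).continuousWithinAt

theorem sub_smul_mem_perp (v : T0 M) (w : TangentSpace (𝓡 7) v.1.1) :
    w - (S.metric.inner v.1.1 v.1.2 w / S.metric.inner v.1.1 v.1.2 v.1.2) • v.1.2 ∈ S.perp v := by
  have h := (S.metric.pos v.1.1 v.1.2 v.2).ne'
  rw [mem_perp, map_sub, map_smul, smul_eq_mul, div_mul_cancel₀ _ h, sub_self]

/-- The orthogonal projection onto a fibre of `I`. -/
noncomputable def proj (v : T0 M) (w : TangentSpace (𝓡 7) v.1.1) : S.Fibre v :=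
  (⟨_, S.sub_smul_mem_perp v w⟩ : S.perp v)

theorem fibreVal_proj (v : T0 M) (w : TangentSpace (𝓡 7) v.1.1) : S.fibreVal v (S.proj v w) =
    w - (S.metric.inner v.1.1 v.1.2 w / S.metric.inner v.1.1 v.1.2 v.1.2) • v.1.2 := rfl

theorem proj_fibreVal (v : T0 M) (w : S.Fibre v) : S.proj v (S.fibreVal v w) = w := by
  apply Subtype.ext
  have h : S.metric.inner v.1.1 v.1.2 (S.fibreVal v w) = 0 :=
    Subtype.property (p := fun u => u ∈ S.perp v) w
  change S.fibreVal v (S.proj v (S.fibreVal v w)) = S.fibreVal v w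
  rw [fibreVal_proj, h, zero_div, zero_smul, sub_zero]

theorem continuousAt_proj {w : ∀ v : T0 M, TangentSpace (𝓡 7) v.1.1} {v : T0 M}
    (hw : ContinuousAt (fun v : T0 M => (⟨v.1.1, w v⟩ : TangentBundle (𝓡 7) M)) v) :
    ContinuousAt (fun v => TotalSpace.mk' (Fin 3 → ℂ) v (S.proj v (w v))) v := by
  have h : ContinuousAt (fun v : T0 M => (⟨v.1.1, v.1.2⟩ : TangentBundle (𝓡 7) M)) v :=
    continuous_subtype_val.continuousAt
  rw [continuousAt_fibre_iff]
  simp only [fibreVal_proj]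
  exact hw.sub_tangent (((S.continuousAt_metric h hw).div (S.continuousAt_metric h h)
    (S.metric.pos v.1.1 v.1.2 v.2).ne').smul_tangent h)

/-- Three vectors at `v₀` with Ω ≠ 0 are extended with constant coordinates in a trivialization of
TM and projected to the fibres of `I`; the projection leaves them unchanged at `v₀`. The condition Ω
≠ 0 is open and forces linear independence, hence a basis by dimension. -/
theorem exists_isComplexFrameOn (v₀ : T0 M) : ∃ (U : Set (T0 M)) (s : Fin 3 → ∀ v, S.Fibre v),
    IsOpen U ∧ v₀ ∈ U ∧ IsComplexFrameOn (Fin 3 → ℂ) U s := by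
  obtain ⟨a, ha⟩ := S.exists_form_ne_zero v₀
  set t := trivializationAt E7 (TangentSpace (𝓡 7)) v₀.1.1
  have hx : Continuous fun v : T0 M => v.1.1 :=
    (FiberBundle.continuous_proj E7 (TangentSpace (𝓡 7))).comp continuous_subtype_val
  let W : Set (T0 M) := (fun v : T0 M => v.1.1) ⁻¹' t.baseSet
  have hW : IsOpen W := t.open_baseSet.preimage hx
  have h₀ : v₀ ∈ W := mem_baseSet_trivializationAt E7 (TangentSpace (𝓡 7)) v₀.1.1
  let s : Fin 3 → ∀ v, S.Fibre v := fun k v =>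
    S.proj v (t.symm v.1.1 (t ⟨v₀.1.1, S.fibreVal v₀ (a k)⟩).2)
  have hs : ∀ k, ContinuousOn (fun v => TotalSpace.mk' (Fin 3 → ℂ) v (s k v)) W :=
    fun k v hv => (S.continuousAt_proj
      (continuousAt_tangentFrame hx.continuousAt hv _)).continuousWithinAt
  have hs₀ : ∀ k, s k v₀ = a k := fun k => by
    change S.proj v₀ (t.symm v₀.1.1 (t ⟨v₀.1.1, S.fibreVal v₀ (a k)⟩).2) = a k
    rw [t.symm_apply_apply_mk h₀, proj_fibreVal]
  refine ⟨W ∩ (fun v => S.volumeForm v fun k => s k v) ⁻¹' {0}ᶜ, s,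
    (S.continuousOn_volumeForm hW hs).isOpen_inter_preimage hW isOpen_compl_singleton,
    ⟨h₀, ?_⟩, ?_⟩
  · change S.volumeForm v₀ (fun k => s k v₀) ≠ 0
    simp only [hs₀]
    exact S.vol_ne_zero ha
  · have hli : ∀ v, S.volumeForm v (fun k => s k v) ≠ 0 → LinearIndependent ℂ fun k => s k v :=
      fun v hv => by
        by_contra h
        exact hv ((S.volumeForm v).map_linearDependent _ h)
    exact ⟨fun k => (hs k).mono inter_subset_left, fun v hv => hli v hv.2, fun v hv =>
      (hli v hv.2).span_eq_top_of_card_eq_finrank (by rw [S.finrank_fibre, Fintype.card_fin])⟩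

end G2Structure

/-- The first Chern class is a relation here, so its existence is proved along with its vanishing;
otherwise the latter could hold vacuously. -/
theorem lemmaL {M : Type*} [TopologicalSpace M] [T2Space M] [ParacompactSpace M]
    [ChartedSpace E7 M] [IsManifold (𝓡 7) ∞ M] (S : G2Structure M) :
    (∃ c : Cech.H2 (T0 M), IsFirstChernClass (Fin 3 → ℂ) S.Fibre 3 c) ∧
      ∀ c : Cech.H2 (T0 M), IsFirstChernClass (Fin 3 → ℂ) S.Fibre 3 c → c = 0 :=
  have hc : ∀ (U : Set (T0 M)) (s : Fin 3 → ∀ v, S.Fibre v), IsOpen U →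
      IsComplexFrameOn (Fin 3 → ℂ) U s →
        ContinuousOn (fun v => S.volumeForm v fun k => s k v) U :=
    fun _ _ hU hs => S.continuousOn_volumeForm hU hs.continuousOn
  ⟨⟨0, isFirstChernClass_zero_of_volumeForm S.volumeForm S.volumeForm_ne_zero hc
    S.exists_isComplexFrameOn⟩,
    fun _ h => h.eq_zero_of_volumeForm S.volumeForm S.volumeForm_ne_zero hc⟩
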